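/- Let $n, q$ be nonnegative integers, and suppose we are given $n$ baskets, where basket $i$ contains a finite (possibly zero) real amount $a_{ij} \ge 0$ of fruit of type $j$, for $1 \le i \le n$ and $1 \le j \le q$; a basket may contain positive amounts of more than one type. Then one can choose at most $(n+q)/2$ of the baskets so that the chosen baskets together contain at least half of the total amount of each type of fruit; that is, there is a set $S \subseteq \{1,\dots,n\}$ with $|S| \le (n+q)/2$ and $$\sum_{i \in S} a_{ij} \ \ge\ \frac12 \sum_{i=1}^n a_{ij} \qquad \text{for every } j = 1,\dots,q.$$ -/

import Mathlib

/-! Weighting baskets by `x` in the cube so that each type totals exactly half is feasible (all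
weights 1/2), so this compact slice has an extreme point, with at most `q` fractional weights.
Rounding up `x` or `1 - x` gives two valid sets that overlap only in fractional baskets; the smaller
one is small enough. -/

open Filter Topology in
/-- An extreme point of the section of the unit cube by the fibre of a linear map `L` has at most
`q` coordinates strictly between `0` and `1`, where `q` is the dimension of the codomain. -/
theorem card_fractional_le_of_mem_extremePoints {n q : ℕ}
    (L : (Fin n → ℝ) →ₗ[ℝ] (Fin q → ℝ)) (b : Fin q → ℝ) {x : Fin n → ℝ}
    (hx : x ∈ (Set.Icc (0 : Fin n → ℝ) 1 ∩ L ⁻¹' {b}).extremePoints ℝ) :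
    (Finset.univ.filter fun i => 0 < x i ∧ x i < 1).card ≤ q := by
  set F := Finset.univ.filter fun i => 0 < x i ∧ x i < 1 with hF
  by_contra! hlt
  -- With over `q` fractional coordinates, `L` kills some nonzero `d` supported on them; `x ± ε • d`
  -- then contradicts extremality.
  let E : (F → ℝ) →ₗ[ℝ] (Fin n → ℝ) := Function.ExtendByZero.linearMap ℝ Subtype.val
  have hker : LinearMap.ker (L ∘ₗ E) ≠ ⊥ :=
    LinearMap.ker_ne_bot_of_finrank_lt (by simpa using hlt)
  obtain ⟨c, hc, hc0⟩ := (Submodule.ne_bot_iff _).1 hker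
  have hLd : L (E c) = 0 := hc
  have hd0 : E c ≠ 0 := fun h => hc0 <| by
    funext i
    have := congrFun h i
    simpa [E, Subtype.val_injective.extend_apply] using this
  have hdF : ∀ i, i ∉ F → E c i = 0 := fun i hi => by
    have : ¬ ∃ y : F, (y : Fin n) = i := by rintro ⟨y, rfl⟩; exact hi y.2
    simp [E, Function.extend_apply' _ _ _ this]
  generalize E c = d at hLd hd0 hdF
  obtain ⟨⟨hxI, hxL⟩, hext⟩ := hx
  have key : ∀ᶠ ε in 𝓝 (0 : ℝ), ∀ i, 0 ≤ x i + ε * d i ∧ x i + ε * d i ≤ 1 := by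
    refine eventually_all.2 fun i => ?_
    by_cases hi : i ∈ F
    · have hi' : 0 < x i ∧ x i < 1 := by simpa [hF] using hi
      have hcont : Tendsto (fun ε : ℝ => x i + ε * d i) (𝓝 0) (𝓝 (x i)) := by
        have : Continuous fun ε : ℝ => x i + ε * d i := by fun_prop
        simpa using this.tendsto 0
      filter_upwards [hcont.eventually (lt_mem_nhds hi'.1), hcont.eventually (gt_mem_nhds hi'.2)]
        with ε h1 h2 using ⟨h1.le, h2.le⟩
    · simp only [hdF i hi, mul_zero, add_zero]
      exact Eventually.of_forall fun _ => ⟨hxI.1 i, hxI.2 i⟩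
  have hneg := (continuous_neg (G := ℝ)).tendsto 0
  rw [neg_zero] at hneg
  obtain ⟨ε, ⟨h1, h2⟩, hε⟩ := ((((key.and (hneg.eventually key)).filter_mono
    nhdsWithin_le_nhds).and (self_mem_nhdsWithin (s := Set.Ioi (0 : ℝ)))).exists)
  have hε : 0 < ε := hε
  have mem : ∀ δ : ℝ, (∀ i, 0 ≤ x i + δ * d i ∧ x i + δ * d i ≤ 1) →
      x + δ • d ∈ Set.Icc (0 : Fin n → ℝ) 1 ∩ L ⁻¹' {b} := fun δ h =>
    ⟨⟨fun i => (h i).1, fun i => (h i).2⟩, by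
      have : L x = b := hxL
      simp [hLd, this]⟩
  have heq := hext (mem ε h1) (mem (-ε) h2)
    ⟨1 / 2, 1 / 2, by norm_num, by norm_num, by norm_num, by module⟩
  have : ε • d = 0 := by simpa using heq
  exact (smul_ne_zero hε.ne' hd0) this

theorem mainTheorem3 (n q : ℕ) (a : Fin n → Fin q → ℝ) (ha : ∀ i j, 0 ≤ a i j) :
    ∃ S : Finset (Fin n), (S.card : ℝ) ≤ ((n : ℝ) + (q : ℝ)) / 2 ∧
      ∀ j : Fin q, (∑ i : Fin n, a i j) / 2 ≤ ∑ i ∈ S, a i j := by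
  let L : (Fin n → ℝ) →ₗ[ℝ] (Fin q → ℝ) := Fintype.linearCombination ℝ a
  have hL : ∀ x j, L x j = ∑ i, x i * a i j := fun x j => by
    simp [L, Fintype.linearCombination_apply]
  let b : Fin q → ℝ := fun j => (∑ i, a i j) / 2
  have hcompact : IsCompact (Set.Icc (0 : Fin n → ℝ) 1 ∩ L ⁻¹' {b}) :=
    isCompact_Icc.inter_right (isClosed_singleton.preimage L.continuous_of_finiteDimensional)
  have hne : (Set.Icc (0 : Fin n → ℝ) 1 ∩ L ⁻¹' {b}).Nonempty := by
    refine ⟨fun _ => 1 / 2, ⟨fun i => ?_, fun i => ?_⟩, ?_⟩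
    · norm_num
    · norm_num
    · refine funext fun j => ?_
      rw [hL, ← Finset.mul_sum]
      simp only [b]
      ring
  obtain ⟨x, hx⟩ := hcompact.extremePoints_nonempty hne
  have hcard := card_fractional_le_of_mem_extremePoints L b hx
  obtain ⟨⟨⟨h0, h1⟩, hxb⟩, -⟩ := hx
  have hsum : ∀ j, ∑ i, x i * a i j = (∑ i, a i j) / 2 := fun j => by
    rw [← hL]; exact congrFun hxb j
  let A := Finset.univ.filter fun i => 0 < x i
  let B := Finset.univ.filter fun i => x i < 1
  have hA : ∀ j, (∑ i, a i j) / 2 ≤ ∑ i ∈ A, a i j := fun j => by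
    rw [← hsum, Finset.sum_filter]
    refine Finset.sum_le_sum fun i _ => ?_
    split_ifs with h
    · exact mul_le_of_le_one_left (ha i j) (h1 i)
    · exact mul_nonpos_of_nonpos_of_nonneg (not_lt.1 h) (ha i j)
  have hB : ∀ j, (∑ i, a i j) / 2 ≤ ∑ i ∈ B, a i j := fun j => by
    -- The target is exactly half, so `1 - x` meets it too.
    have : (∑ i, a i j) / 2 = ∑ i, (1 - x i) * a i j := by
      simp only [sub_mul, one_mul, Finset.sum_sub_distrib, hsum]
      ring
    rw [this, Finset.sum_filter]
    refine Finset.sum_le_sum fun i _ => ?_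
    split_ifs with h
    · exact mul_le_of_le_one_left (ha i j) (by linarith [show 0 ≤ x i from h0 i])
    · exact mul_nonpos_of_nonpos_of_nonneg (by linarith) (ha i j)
  have hAB : A.card + B.card ≤ n + q := by
    -- `A ∩ B` is the set of fractional coordinates.
    rw [← Finset.card_union_add_card_inter, ← Finset.filter_and]
    exact add_le_add (by simpa using Finset.card_le_univ (A ∪ B)) hcard
  have hAB' : (A.card : ℝ) + B.card ≤ n + q := mod_cast hAB
  rcases le_total (A.card : ℝ) B.card with h | h
  · exact ⟨A, by linarith, hA⟩
  · exact ⟨B, by linarith, hB⟩
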